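/- \textbf{Setting.} Write $S^3=\{(z,w)\in\mathbb C^2 : |z|^2+|w|^2=1\}$, oriented as the boundary of the unit ball, and let $F=\{(\tfrac{1}{\sqrt2}e^{i\alpha},\tfrac{1}{\sqrt2}e^{i\beta})\}$ be the standard unknotted torus, with $\alpha$ its meridional and $\beta$ its longitudinal angle. For positive integers $p,q$ the torus link $T(p,q)\subset F$ is the set of points of $F$ with $q\alpha-p\beta\in 2\pi\mathbb Z$; it consists of $\gcd(p,q)$ parallel curves and wraps $p$ times in the meridional and $q$ times in the longitudinal direction. For $2\le r\le p+q$ let $D\subset S^3$ be a disk that meets $F$ in an arc on which $\alpha+\beta$ is constant, $\alpha$ is increasing with total increase less than $2\pi$, and whose interior contains exactly $r$ (necessarily adjacent) points of $T(p,q)$, the disk $D$ being disjoint from the rest of $T(p,q)$. For an integer $s$, the \emph{twisted torus link} $T(p,q;r,s)$ is the link in $S^3$ obtained from $T(p,q)$ by performing $s$ full twists along $D$ on these $r$ parallel strands: in a solid cylinder $D\times[0,1]$ that $T(p,q)$ meets exactly in the $r$ strands, the disk at height $t$ is rotated by the angle $2\pi s t$, right-handedly for $s>0$. (Equivalently, it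 is the result of surgery on the unknotted circle $J=\partial D$ which inserts $s$ full twists.) Two links in $S^3$ are \emph{equivalent} if an ambient isotopy of $S^3$ carries one to the other. \textbf{Proposition.} Let $p,q,r,s$ be integers with $p,q>1$ and $2\le r\le p+q$. Then the twisted torus links $T(p,q;r,s)$ and $T(q,p;r,s)$ are equivalent. -/

import Mathlib

noncomputable section

namespace TwistedTorus

open Complex (I)

/-- The unit sphere `S³` in `ℂ²`, oriented as the boundary of the unit ball. -/
abbrev S3 : Type := Metric.sphere (0 : EuclideanSpace ℂ (Fin 2)) 1

theorem toroidal_mem (ρ α β : ℝ) :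
    !₂[(Real.cos ρ : ℂ) * Complex.exp (α * I), (Real.sin ρ : ℂ) * Complex.exp (β * I)] ∈
      Metric.sphere (0 : EuclideanSpace ℂ (Fin 2)) 1 := by
  rw [mem_sphere_zero_iff_norm, EuclideanSpace.norm_eq, Real.sqrt_eq_one]
  simp only [Fin.sum_univ_two, Matrix.cons_val_zero, Matrix.cons_val_one, norm_mul,
    Complex.norm_exp_ofReal_mul_I, Complex.norm_real, Real.norm_eq_abs, mul_one, sq_abs]
  exact Real.cos_sq_add_sin_sq ρ

/-- Toroidal coordinates on `S³`: the point `(cos ρ · e^{iα}, sin ρ · e^{iβ})`. -/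
def toroidal (ρ α β : ℝ) : S3 :=
  ⟨!₂[(Real.cos ρ : ℂ) * Complex.exp (α * I), (Real.sin ρ : ℂ) * Complex.exp (β * I)],
    toroidal_mem ρ α β⟩

/-- The standard unknotted torus `F = {ρ = π/4}`; it bounds the solid torus `{ρ ≥ π/4}`, for which
`α` is the meridional angle and `β` the longitudinal angle. -/
def unknottedTorus : Set S3 :=
  {P | ∃ α β : ℝ, P = toroidal (Real.pi / 4) α β}

/-- The torus link `T(p,q)`: the points of `F` whose angles satisfy `q α - p β ∈ 2πℤ`. For `p, q`
positive and `d = gcd p q` these are `d` parallel closed curves, each running `p/d` times in the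
direction of `α` and `q/d` times in the direction of `β`. -/
def torusLink (p q : ℕ) : Set S3 :=
  {P | ∃ (α β : ℝ) (k : ℤ), (q : ℝ) * α - (p : ℝ) * β = 2 * Real.pi * k ∧
    P = toroidal (Real.pi / 4) α β}

/-- A solid cylinder `(unit disc) × [0,1] → S³` around `r` adjacent strands of `T(p,q)`.

With `x` the first and `ρ` the second coordinate in the disc direction and `t` the height, a point
has angles `(α, β) = (x, -x) + t' (p, q)`, where `t' = π t / (p + q)`. The disc of height `t` meets
the torus `F` in an arc `{ρ = π/4}` that is transverse to the strands (`x` varies). The strands are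
the lines `(p + q) x ∈ 2πℤ`, in the direction of the height; the arc, which has centre
`x = (r-1)π/(p+q)` and half-length `(r - 1/2)π/(p+q)`, meets the `r` strands `x = 2πj/(p+q)`,
`0 ≤ j < r`, and no others. The coordinates `(re ζ, im ζ, t)` are positively oriented in `S³`. -/
def strandCylinder (p q r : ℕ) (y : ℂ × ℝ) : S3 :=
  let x : ℝ := ((r : ℝ) - 1) * Real.pi / (p + q) + ((r : ℝ) - 1 / 2) * Real.pi / (p + q) * y.1.re
  let t' : ℝ := Real.pi / (p + q) * y.2
  toroidal (Real.pi / 4 + Real.pi / 8 * y.1.im) (x + p * t') (-x + q * t')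

/-- The solid cylinder `(closed unit disc) × [0,1]`. -/
def solidCylinder : Set (ℂ × ℝ) := Metric.closedBall 0 1 ×ˢ Set.Icc 0 1

/-- `s` full twists of the solid cylinder: the disc of height `t` is rotated by `2π s t`. This is
the identity on both end discs; for `s > 0` vertical strands become right-handed helices. -/
def fullTwists (s : ℤ) (y : ℂ × ℝ) : ℂ × ℝ :=
  (Complex.exp (2 * Real.pi * s * y.2 * I) * y.1, y.2)

/-- The result of inserting `s` full twists into `L` along the embedded cylinder `φ`: outside of the
cylinder `L` is unchanged, and inside of it `L` is replaced by its image under the full twists. -/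
def insertFullTwists (φ : ℂ × ℝ → S3) (s : ℤ) (L : Set S3) : Set S3 :=
  (L \ φ '' solidCylinder) ∪ (φ ∘ fullTwists s) '' (solidCylinder ∩ φ ⁻¹' L)

/-- The twisted torus link `T(p,q;r,s)`: `s` full twists on `r` adjacent strands of `T(p,q)`. -/
def twistedTorusLink (p q r : ℕ) (s : ℤ) : Set S3 :=
  insertFullTwists (strandCylinder p q r) s (torusLink p q)

/-- Equivalence of (unoriented) links in `S³`: there is an ambient isotopy carrying `L` to `L'`. -/
def LinkEquivalent (L L' : Set S3) : Prop :=
  ∃ H : unitInterval × S3 → S3, Continuous H ∧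
    (∀ t, IsHomeomorph fun P => H (t, P)) ∧
    (∀ P, H (0, P) = P) ∧
    (fun P => H (1, P)) '' L = L'

end TwistedTorus

end

/-! Exchanging the two complex coordinates swaps the solid tori on either side of $F$ and carries
$T(p,q)$ to $T(q,p)$. Composing with opposite phase shifts $e^{\pm i\theta}$ keeps this a unitary
involution, and one choice of $\theta$ (`arcShift`) also matches the twisting cylinders
(`sphereSwap_strandCylinder`): the radial coordinate and the arc coordinate both change sign, so the
cylinders correspond up to a half-turn about the axis. A half-turn commutes with full twists of the
same sign and number, so the swap carries one twisted link onto the other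
(`image_insertFullTwists`). Rotating the $(-1)$-eigenvalue of the involution along the unit circle
from $1$ to $-1$ gives the ambient isotopy (`linkEquivalent_of_involution`). -/

namespace TwistedTorus

open Complex (I)

section InvolutionPath

variable {E : Type*} [NormedAddCommGroup E] [InnerProductSpace ℂ E]

/-- The unitary map with eigenvalue `1` on the `1`-eigenspace of the involution `U` and eigenvalue
`c` on its `(-1)`-eigenspace. -/
noncomputable def involutionPath (U : E →ₗᵢ[ℂ] E) (c : ℂ) (x : E) : E :=
  (2⁻¹ : ℂ) • (x + U x) + c • (2⁻¹ : ℂ) • (x - U x)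

theorem involutionPath_one (U : E →ₗᵢ[ℂ] E) (x : E) : involutionPath U 1 x = x := by
  unfold involutionPath; module

theorem involutionPath_neg_one (U : E →ₗᵢ[ℂ] E) (x : E) : involutionPath U (-1) x = U x := by
  unfold involutionPath; module

theorem involutionPath_mul (U : E →ₗᵢ[ℂ] E) (hU : ∀ x, U (U x) = x) (c d : ℂ) (x : E) :
    involutionPath U c (involutionPath U d x) = involutionPath U (c * d) x := by
  simp only [involutionPath, map_add, map_sub, map_smul, hU]
  module

theorem norm_involutionPath (U : E →ₗᵢ[ℂ] E) (hU : ∀ x, U (U x) = x) {c : ℂ} (hc : ‖c‖ = 1)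
    (x : E) : ‖involutionPath U c x‖ = ‖x‖ := by
  -- An isometric involution is self-adjoint, so its two eigencomponents are orthogonal. By
  -- Pythagoras the norm depends on `c` only through `‖c‖`, which allows comparison with `c = 1`.
  have orth (c : ℂ) :
      inner ℂ ((2⁻¹ : ℂ) • (x + U x)) (c • (2⁻¹ : ℂ) • (x - U x)) = 0 := by
    have h : inner ℂ (U x) x = inner ℂ x (U x) := by
      conv_rhs => rw [← U.inner_map_map x (U x), hU]
    simp only [inner_smul_left, inner_smul_right, inner_add_left, inner_sub_right,
      U.inner_map_map, h]
    ring
  have pyth (c : ℂ) := norm_add_sq_eq_norm_sq_add_norm_sq_of_inner_eq_zero _ _ (orth c)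
  have h₁ := pyth 1
  have h₂ := pyth c
  have h₃ : (2⁻¹ : ℂ) • (x + U x) + (1 : ℂ) • (2⁻¹ : ℂ) • (x - U x) = x :=
    involutionPath_one U x
  rw [h₃] at h₁
  rw [norm_smul c, hc] at h₂
  rw [norm_smul (1 : ℂ), norm_one] at h₁
  exact (mul_self_inj (norm_nonneg _) (norm_nonneg _)).1 (h₂.trans h₁.symm)

end InvolutionPath

/-- The homeomorphism of `S³` induced by an involution of `ℂ²` and a unit complex number. -/
noncomputable def sphereHomeomorph (U : EuclideanSpace ℂ (Fin 2) →ₗᵢ[ℂ] EuclideanSpace ℂ (Fin 2))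
    (hU : ∀ x, U (U x) = x) (c : Circle) : S3 ≃ₜ S3 where
  toFun P := ⟨involutionPath U c P, by
    rw [mem_sphere_zero_iff_norm, norm_involutionPath U hU c.norm_coe, norm_eq_of_mem_sphere]⟩
  invFun P := ⟨involutionPath U (c⁻¹ : Circle) P, by
    rw [mem_sphere_zero_iff_norm, norm_involutionPath U hU (c⁻¹).norm_coe, norm_eq_of_mem_sphere]⟩
  left_inv P := Subtype.ext <| by
    simp only [involutionPath_mul U hU, ← Circle.coe_mul, inv_mul_cancel, Circle.coe_one,
      involutionPath_one]
  right_inv P := Subtype.ext <| by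
    simp only [involutionPath_mul U hU, ← Circle.coe_mul, mul_inv_cancel, Circle.coe_one,
      involutionPath_one]
  continuous_toFun := by unfold involutionPath; fun_prop
  continuous_invFun := by unfold involutionPath; fun_prop

/-- A unitary involution of `ℂ²` is isotopic to the identity on `S³`. -/
theorem linkEquivalent_of_involution
    (U : EuclideanSpace ℂ (Fin 2) →ₗᵢ[ℂ] EuclideanSpace ℂ (Fin 2)) (hU : ∀ x, U (U x) = x)
    {f : S3 → S3} (hf : ∀ P, (f P : EuclideanSpace ℂ (Fin 2)) = U P) (L : Set S3) :
    LinkEquivalent L (f '' L) := by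
  refine ⟨fun y => sphereHomeomorph U hU (Circle.exp (Real.pi * y.1)) y.2, ?_,
    fun t => (sphereHomeomorph U hU (Circle.exp (Real.pi * t))).isHomeomorph,
    fun P => Subtype.ext ?_, ?_⟩
  · have hx : Continuous fun y : unitInterval × S3 => (y.2 : EuclideanSpace ℂ (Fin 2)) := by
      fun_prop
    have hc : Continuous fun y : unitInterval × S3 => (Circle.exp (Real.pi * y.1) : ℂ) := by
      fun_prop
    have hUx := U.continuous.comp hx
    exact Continuous.subtype_mk
      (((hx.add hUx).const_smul (2⁻¹ : ℂ)).add
        (hc.smul ((hx.sub hUx).const_smul (2⁻¹ : ℂ)))) _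
  · simp [sphereHomeomorph, involutionPath_one]
  · congr 1
    funext P
    apply Subtype.ext
    simp [sphereHomeomorph, involutionPath_neg_one, hf]

/-- The unitary involution `(z, w) ↦ (e^{iθ} w, e^{-iθ} z)`. -/
noncomputable def twistedSwap (θ : ℝ) :
    EuclideanSpace ℂ (Fin 2) →ₗᵢ[ℂ] EuclideanSpace ℂ (Fin 2) where
  toFun v := !₂[Complex.exp (θ * I) * v 1, Complex.exp ((-θ : ℝ) * I) * v 0]
  map_add' v w := by ext i; fin_cases i <;> simp [mul_add]
  map_smul' a v := by ext i; fin_cases i <;> simp [mul_left_comm]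
  norm_map' v := by
    change ‖(!₂[_, _] : EuclideanSpace ℂ (Fin 2))‖ = _
    simp only [EuclideanSpace.norm_eq, Fin.sum_univ_two, Matrix.cons_val_zero,
      Matrix.cons_val_one, norm_mul, Complex.norm_exp_ofReal_mul_I, one_mul]
    rw [add_comm]

theorem twistedSwap_apply (θ : ℝ) (v : EuclideanSpace ℂ (Fin 2)) :
    twistedSwap θ v = !₂[Complex.exp (θ * I) * v 1, Complex.exp ((-θ : ℝ) * I) * v 0] := rfl

theorem twistedSwap_twistedSwap (θ : ℝ) (v : EuclideanSpace ℂ (Fin 2)) :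
    twistedSwap θ (twistedSwap θ v) = v := by
  ext i
  fin_cases i <;> simp [twistedSwap_apply, ← mul_assoc, ← Complex.exp_add]

/-- The restriction of `twistedSwap θ` to `S³`. -/
noncomputable def sphereSwap (θ : ℝ) (P : S3) : S3 :=
  ⟨twistedSwap θ P, by
    rw [mem_sphere_zero_iff_norm, LinearIsometry.norm_map, norm_eq_of_mem_sphere]⟩

theorem sphereSwap_involutive (θ : ℝ) : Function.Involutive (sphereSwap θ) :=
  fun _ => Subtype.ext (twistedSwap_twistedSwap θ _)

/-- Since `π/4` is fixed by `ρ ↦ π/2 - ρ`, the torus $F$ is preserved and its two sides are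
exchanged. -/
theorem sphereSwap_toroidal (θ ρ α β : ℝ) :
    sphereSwap θ (toroidal ρ α β) = toroidal (Real.pi / 2 - ρ) (β + θ) (α - θ) := by
  apply Subtype.ext
  ext i
  fin_cases i <;>
    simp only [sphereSwap, toroidal, twistedSwap_apply, Real.cos_pi_div_two_sub,
      Real.sin_pi_div_two_sub, Fin.zero_eta, Fin.mk_one, PiLp.toLp_apply, Matrix.cons_val_zero,
      Matrix.cons_val_one, Complex.ofReal_add, Complex.ofReal_sub, Complex.ofReal_neg, add_mul,
      sub_mul, neg_mul, Complex.exp_add, Complex.exp_sub, Complex.exp_neg] <;> ring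

/-- The translation angle which matches the arcs of the cylinders for `(p, q)` and `(q, p)`. -/
noncomputable def arcShift (p q r : ℕ) : ℝ := 2 * (((r : ℝ) - 1) * Real.pi / (p + q))

theorem arcShift_comm (p q r : ℕ) : arcShift q p r = arcShift p q r := by
  rw [arcShift, arcShift, add_comm (q : ℝ)]

theorem sphereSwap_mem_torusLink {p q : ℕ} (h : p + q ≠ 0) (r : ℕ) {P : S3}
    (hP : P ∈ torusLink p q) : sphereSwap (arcShift p q r) P ∈ torusLink q p := by
  obtain ⟨α, β, k, hk, rfl⟩ := hP
  -- The swap negates `q α - p β` and the shift adds `(p + q) * arcShift p q r = 2π(r - 1)`; this is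
  -- a multiple of `2π`, so links go to links.
  refine ⟨β + arcShift p q r, α - arcShift p q r, r - 1 - k, ?_, ?_⟩
  · have hpq : (p : ℝ) + q ≠ 0 := by exact_mod_cast h
    have hs : ((p : ℝ) + q) * arcShift p q r = 2 * Real.pi * (r - 1) := by
      unfold arcShift
      field_simp
    push_cast
    linear_combination hs - hk
  · rw [sphereSwap_toroidal]
    congr 1
    ring

theorem sphereSwap_mem_torusLink_iff {p q : ℕ} (h : p + q ≠ 0) (r : ℕ) (P : S3) :
    sphereSwap (arcShift p q r) P ∈ torusLink q p ↔ P ∈ torusLink p q := by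
  refine ⟨fun hP => ?_, sphereSwap_mem_torusLink h r⟩
  -- The converse is the forward direction with `p` and `q` exchanged, because the swap is its own
  -- inverse.
  have := sphereSwap_mem_torusLink (by omega) r hP
  rwa [arcShift_comm, sphereSwap_involutive] at this

/-- The half-turn of the solid cylinder about its axis. -/
def halfTurn (y : ℂ × ℝ) : ℂ × ℝ := (-y.1, y.2)

theorem halfTurn_involutive : Function.Involutive halfTurn := fun y => by simp [halfTurn]

theorem fullTwists_halfTurn (s : ℤ) (y : ℂ × ℝ) :
    fullTwists s (halfTurn y) = halfTurn (fullTwists s y) := by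
  simp [fullTwists, halfTurn]

theorem halfTurn_mem_solidCylinder {y : ℂ × ℝ} :
    halfTurn y ∈ solidCylinder ↔ y ∈ solidCylinder := by
  simp [halfTurn, solidCylinder]

/-- The swap sends the arc coordinate `x` to `arcShift p q r - x`. The shift is twice the centre of
the arc, so this is the reflection in that centre; together with the reflection of `ρ` in `π/4` it
is a half-turn, and heights are unchanged. -/
theorem sphereSwap_strandCylinder (p q r : ℕ) (y : ℂ × ℝ) :
    sphereSwap (arcShift p q r) (strandCylinder p q r y) = strandCylinder q p r (halfTurn y) := by
  simp only [strandCylinder, sphereSwap_toroidal, halfTurn, arcShift, Complex.neg_re,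
    Complex.neg_im, add_comm (q : ℝ)]
  congr 1 <;> ring

/-- Inserting full twists is natural with respect to bijections which match the links and match the
cylinders up to a half-turn. -/
theorem image_insertFullTwists {f : S3 → S3} (hf : Function.Bijective f) {φ ψ : ℂ × ℝ → S3}
    (hφ : ∀ y, f (φ y) = ψ (halfTurn y)) {L M : Set S3} (hL : ∀ P, f P ∈ M ↔ P ∈ L) (s : ℤ) :
    f '' insertFullTwists φ s L = insertFullTwists ψ s M := by
  have hLM : f '' L = M := by
    rw [show L = f ⁻¹' M from Set.ext fun P => (hL P).symm, Set.image_preimage_eq M hf.surjective]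
  have hC : halfTurn '' solidCylinder = solidCylinder := by
    rw [halfTurn_involutive.image_eq_preimage_symm]
    exact Set.ext fun y => halfTurn_mem_solidCylinder
  have hcyl : f '' (φ '' solidCylinder) = ψ '' solidCylinder := by
    conv_rhs => rw [← hC]
    simp only [Set.image_image, hφ]
  -- The half-turn matches the untwisted strands in the two parameter cylinders; commuting with
  -- `fullTwists s`, it then matches the twisted ones.
  have hstr : halfTurn '' (solidCylinder ∩ φ ⁻¹' L) = solidCylinder ∩ ψ ⁻¹' M := by
    rw [halfTurn_involutive.image_eq_preimage_symm]
    ext y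
    simp only [Set.mem_preimage, Set.mem_inter_iff, halfTurn_mem_solidCylinder, ← hL, hφ,
      halfTurn_involutive y]
  rw [insertFullTwists, insertFullTwists, Set.image_union, Set.image_sdiff hf.injective, hLM, hcyl,
    ← hstr]
  simp only [Set.image_image, Function.comp_apply, hφ, fullTwists_halfTurn]

end TwistedTorus

theorem mainTheorem10 (p q r : ℕ) (s : ℤ) (hp : 1 < p) (hq : 1 < q)
    (hr : 2 ≤ r) (hrpq : r ≤ p + q) :
    TwistedTorus.LinkEquivalent
      (TwistedTorus.twistedTorusLink p q r s) (TwistedTorus.twistedTorusLink q p r s) := by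
  have h := TwistedTorus.image_insertFullTwists
    (TwistedTorus.sphereSwap_involutive (TwistedTorus.arcShift p q r)).bijective
    (TwistedTorus.sphereSwap_strandCylinder p q r)
    (TwistedTorus.sphereSwap_mem_torusLink_iff (by omega) r) s
  rw [TwistedTorus.twistedTorusLink, TwistedTorus.twistedTorusLink, ← h]
  exact TwistedTorus.linkEquivalent_of_involution _
    (TwistedTorus.twistedSwap_twistedSwap (TwistedTorus.arcShift p q r)) (fun _ => rfl) _
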